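/- Let $\theta>0$ and $\sigma\in\mathbb R$. Let $X=(X_t)_{t\ge 0}$ be the zero-mean Ornstein–Uhlenbeck process started at $0$ with reversion rate $\theta$ and diffusion coefficient $\sigma$, i.e. a continuous solution of $dX_t=-\theta X_t\,dt+\sigma\,dB_t$, $X_0=0$, for some standard Wiener process $B$, and let $W=(W_t)_{t\ge 0}$ be a standard Wiener process, possibly on another probability space. Then for every $T>0$ the random variables $\int_0^T X_s\,ds$ and $\int_0^T W_s\,ds$ are square-integrable, $$\operatorname{Var}\Big(\int_0^T X_s\,ds\Big)=\frac{\sigma^2}{2\theta^3}\Big(2\theta T+2(e^{-\theta T}-1)-(1-e^{-\theta T})^2\Big),\qquad \operatorname{Var}\Big(\int_0^T W_s\,ds\Big)=\frac{T^3}{3},$$ and the integrated Ornstein–Uhlenbeck process has at most the variance of the integrated Wiener process with the same diffusion coefficient: $$\operatorname{Var}\Big(\int_0^T X_s\,ds\Big)\le\operatorname{Var}\Big(\int_0^T \sigma W_s\,ds\Big).$$ In particular, if $|\sigma|\le 1$ (for example $\sigma=1$), then $\operatorname{Var}\big(\int_0^T X_s\,ds\big)\le\operatorname{Var}\big(\int_0^T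 W_s\,ds\big)$. -/

import Mathlib

open MeasureTheory ProbabilityTheory
open scoped NNReal

/-- The random variable `∫_0^T Y_s ds`, for a real process `Y` indexed by the times `s ≥ 0`. -/
noncomputable def timeIntegral {Ω : Type*} (Y : ℝ≥0 → Ω → ℝ) (T : ℝ) (ω : Ω) : ℝ :=
  ∫ s in (0 : ℝ)..T, Y s.toNNReal ω

/-- `X` is an Ornstein-Uhlenbeck process with reversion rate `θ`, mean `μ`, diffusion coefficient
`σ` and starting point `x₀`: a process with almost surely continuous paths which, for some
standard Brownian motion `B` on the same probability space, solves the stochastic differential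
equation `dX_t = -θ (X_t - μ) dt + σ dB_t`, `X_0 = x₀`. Since `σ` is constant and `B_0 = 0` almost
surely, the stochastic integral `∫_0^t σ dB_s` is `σ B_t`, so that the equation in integrated form
holds path by path. -/
structure IsOrnsteinUhlenbeck {Ω : Type*} [MeasurableSpace Ω] (X : ℝ≥0 → Ω → ℝ) (P : Measure Ω)
    (θ μ σ x₀ : ℝ) : Prop where
  aemeasurable : ∀ t, AEMeasurable (X t) P
  cont : ∀ᵐ ω ∂P, Continuous (X · ω)
  sde : ∃ B : ℝ≥0 → Ω → ℝ, IsBrownianReal B P ∧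
    ∀ᵐ ω ∂P, ∀ t : ℝ≥0,
      X t ω = x₀ + (∫ s in (0 : ℝ)..t, -θ * (X s.toNNReal ω - μ)) + σ * B t ω

/-! No stochastic integration is needed. Path by path, `I t = ∫_0^t X` solves the linear equation
`I' = -θ I + σ B` with `I 0 = 0`, so `I T = σ ∫_0^T exp (-θ (T - s)) B_s ds`
(`integral_eq_of_langevin`). Both integrated processes are thus weighted time integrals of a
Brownian motion, with weight `g s = exp (-θ (T - s))` or `1`, and Fubini gives `∬ g s * g t * min s
t` for the variance (`IsBrownianReal.weighted_integral`). Since `0 ≤ g ≤ 1` on `[0, T]` and the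
kernel is nonnegative there, the comparison is pointwise under the integral; the closed forms come
from explicit antiderivatives. -/

open Filter Topology Set in
/-- A process with almost surely continuous paths and almost everywhere measurable coordinates is
jointly almost everywhere measurable. -/
lemma aestronglyMeasurable_uncurry_of_ae_continuous {Ω : Type*} [MeasurableSpace Ω]
    {P : Measure Ω} [SFinite P] {Y : ℝ≥0 → Ω → ℝ} (hm : ∀ t, AEMeasurable (Y t) P)
    (hc : ∀ᵐ ω ∂P, Continuous (Y · ω)) (μ : Measure ℝ) [SFinite μ] :
    AEStronglyMeasurable (fun p : ℝ × Ω ↦ Y p.1.toNNReal p.2) (μ.prod P) := by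
  choose Z hZm hZ using hm
  -- Sampling at the grid times `⌊t n⌋ / n` involves only countably many coordinates, so measurable
  -- versions agree with `Y` at all of them off one null set; continuity of paths then gives the
  -- limit.
  have hC : ∀ n : ℕ, Measurable
      (fun p : ℝ × Ω ↦ Z ((⌊(p.1.toNNReal : ℝ) * n⌋₊ : ℝ≥0) / n) p.2) := by
    intro n
    have h1 : Measurable (fun z : ℕ × Ω ↦ Z ((z.1 : ℝ≥0) / n) z.2) :=
      measurable_from_prod_countable_right fun k ↦ hZm ((k : ℝ≥0) / n)
    have h2 : Measurable (fun p : ℝ × Ω ↦ ((⌊(p.1.toNNReal : ℝ) * n⌋₊ : ℕ), p.2)) := by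
      refine Measurable.prodMk (Nat.measurable_floor.comp ?_) measurable_snd
      fun_prop
    exact h1.comp h2
  refine aestronglyMeasurable_of_tendsto_ae atTop (fun n ↦ (hC n).aestronglyMeasurable) ?_
  have hq : ∀ᵐ ω ∂P, ∀ n k : ℕ, Y ((k : ℝ≥0) / n) ω = Z ((k : ℝ≥0) / n) ω :=
    ae_all_iff.2 fun n ↦ ae_all_iff.2 fun k ↦ hZ _
  have hlim : ∀ᵐ ω ∂P, ∀ t : ℝ, Tendsto (fun n : ℕ ↦ Z ((⌊(t.toNNReal : ℝ) * n⌋₊ : ℝ≥0) / n) ω) atTop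
      (𝓝 (Y t.toNNReal ω)) := by
    filter_upwards [hq, hc] with ω h1 h2 t
    have h3 : Tendsto (fun n : ℕ ↦ (⌊(t.toNNReal : ℝ) * n⌋₊ : ℝ≥0) / n) atTop (𝓝 t.toNNReal) := by
      rw [← NNReal.tendsto_coe]
      push_cast
      exact (tendsto_nat_floor_mul_div_atTop (NNReal.coe_nonneg _)).comp
        tendsto_natCast_atTop_atTop
    exact ((h2.tendsto _).comp h3).congr fun n ↦ h1 _ _
  filter_upwards [Measure.quasiMeasurePreserving_snd.ae hlim] with p hp using hp p.1

lemma integrable_prod_of_integral_norm_le {α β : Type*} [MeasurableSpace α] [MeasurableSpace β]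
    {μ : Measure α} [IsFiniteMeasure μ] {ν : Measure β} [SFinite ν] {f : α × β → ℝ}
    (hf : AEStronglyMeasurable f (μ.prod ν)) (hi : ∀ a, Integrable (fun b ↦ f (a, b)) ν) (M : ℝ)
    (hM : ∀ᵐ a ∂μ, ∫ b, ‖f (a, b)‖ ∂ν ≤ M) : Integrable f (μ.prod ν) := by
  refine (integrable_prod_iff hf).2 ⟨ae_of_all _ hi, ?_⟩
  refine (integrable_const M).mono' hf.norm.integral_prod_right' ?_
  filter_upwards [hM] with a ha
  rwa [Real.norm_of_nonneg (integral_nonneg fun _ ↦ norm_nonneg _)]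

/-! ### Second moments of Brownian time integrals -/

lemma ProbabilityTheory.IsPreBrownianReal.integral_mul_eval {Ω : Type*} [MeasurableSpace Ω]
    {P : Measure Ω} {B : ℝ≥0 → Ω → ℝ} (hB : IsPreBrownianReal B P) (s t : ℝ≥0) :
    ∫ ω, B s ω * B t ω ∂P = min (s : ℝ) t := by
  have := hB.isGaussianProcess.isProbabilityMeasure
  have h := hB.covariance_eval s t
  rw [covariance_eq_sub (hB.isGaussianProcess.hasGaussianLaw_eval s).memLp_two
    (hB.isGaussianProcess.hasGaussianLaw_eval t).memLp_two, hB.integral_eval] at h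
  simpa using h

/-- Weighted time integrals of Brownian motion are square-integrable, with the variance given by
the covariance kernel. -/
lemma ProbabilityTheory.IsBrownianReal.weighted_integral {Ω : Type*} [MeasurableSpace Ω]
    {P : Measure Ω} {B : ℝ≥0 → Ω → ℝ} (hB : IsBrownianReal B P) {g : ℝ → ℝ} (hg : Continuous g)
    {T : ℝ} (hT : 0 ≤ T) :
    MemLp (fun ω ↦ ∫ s in (0 : ℝ)..T, g s * B s.toNNReal ω) 2 P ∧
    variance (fun ω ↦ ∫ s in (0 : ℝ)..T, g s * B s.toNNReal ω) P =
      ∫ s in (0 : ℝ)..T, ∫ t in (0 : ℝ)..T, g s * g t * min s t := by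
  have := hB.isGaussianProcess.isProbabilityMeasure
  simp_rw [intervalIntegral.integral_of_le hT]
  set μ : Measure ℝ := volume.restrict (Set.Ioc 0 T) with hμ
  set F : ℝ → Ω → ℝ := fun s ω ↦ g s * B s.toNNReal ω with hF
  have hL2 : ∀ s, MemLp (F s) 2 P := fun s ↦
    (hB.isGaussianProcess.hasGaussianLaw_eval s.toNNReal).memLp_two.const_mul (g s)
  have hFm : AEStronglyMeasurable (fun p : ℝ × Ω ↦ F p.1 p.2) (μ.prod P) :=
    AEStronglyMeasurable.mul
      (hg.measurable.comp measurable_fst).aestronglyMeasurable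
      (aestronglyMeasurable_uncurry_of_ae_continuous hB.aemeasurable hB.cont μ)
  have hFF : ∀ s t, ∫ ω, F s ω * F t ω ∂P = g s * g t * min (s.toNNReal : ℝ) t.toNNReal := by
    intro s t
    rw [← hB.integral_mul_eval, ← integral_const_mul]
    congr 1 with ω
    simp only [hF]; ring
  -- `M` bounds the second moment of `F s` on `[0, T]`. By AM-GM it also bounds `E|F s|` by `(1 + M)
  -- / 2` and `E|F s * F t|` by `M`, as Fubini requires.
  obtain ⟨M, hM⟩ := (isCompact_Icc (a := (0 : ℝ)) (b := T)).exists_bound_of_continuousOn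
    (f := fun s ↦ g s * g s * min (s.toNNReal : ℝ) s.toNNReal) (by fun_prop)
  have hmem : ∀ᵐ s ∂μ, s ∈ Set.Ioc 0 T := ae_restrict_mem measurableSet_Ioc
  have hsq : ∀ᵐ s ∂μ, ∫ ω, F s ω * F s ω ∂P ≤ M := by
    filter_upwards [hmem] with s hs
    rw [hFF]
    exact (le_abs_self _).trans (hM s (Set.Ioc_subset_Icc_self hs))
  have hFi : Integrable (fun p : ℝ × Ω ↦ F p.1 p.2) (μ.prod P) := by
    refine integrable_prod_of_integral_norm_le hFm
      (fun s ↦ (hL2 s).integrable one_le_two) ((1 + M) / 2) ?_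
    filter_upwards [hsq] with s hs
    have h2 : Integrable (fun ω ↦ F s ω * F s ω) P := (hL2 s).integrable_mul (hL2 s)
    calc ∫ ω, ‖F s ω‖ ∂P ≤ ∫ ω, (1 + F s ω * F s ω) / 2 ∂P := by
          refine integral_mono ((hL2 s).integrable one_le_two).norm
            (((integrable_const 1).add h2).div_const 2) fun ω ↦ ?_
          simp only [Real.norm_eq_abs]
          nlinarith [sq_nonneg (|F s ω| - 1), abs_mul_abs_self (F s ω)]
      _ = (1 + ∫ ω, F s ω * F s ω ∂P) / 2 := by
          rw [integral_div, integral_add (integrable_const 1) h2]; simp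
      _ ≤ (1 + M) / 2 := by linarith
  -- The square of the time integral is a double time integral, so this one integrability yields
  -- both square-integrability and the exchange that computes the variance.
  have hFFi : Integrable (fun p : (ℝ × ℝ) × Ω ↦ F p.1.1 p.2 * F p.1.2 p.2)
      ((μ.prod μ).prod P) := by
    have hm1 : AEStronglyMeasurable (fun p : (ℝ × ℝ) × Ω ↦ F p.1.1 p.2)
        ((μ.prod μ).prod P) :=
      hFm.comp_quasiMeasurePreserving
        (QuasiMeasurePreserving.prodMap Measure.quasiMeasurePreserving_fst (.id P))
    have hm2 : AEStronglyMeasurable (fun p : (ℝ × ℝ) × Ω ↦ F p.1.2 p.2)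
        ((μ.prod μ).prod P) :=
      hFm.comp_quasiMeasurePreserving
        (QuasiMeasurePreserving.prodMap Measure.quasiMeasurePreserving_snd (.id P))
    refine integrable_prod_of_integral_norm_le (hm1.mul hm2)
      (fun a ↦ (hL2 a.1).integrable_mul (hL2 a.2)) M ?_
    filter_upwards [Measure.quasiMeasurePreserving_fst.ae hsq,
      Measure.quasiMeasurePreserving_snd.ae hsq] with a h1 h2
    have i1 : Integrable (fun ω ↦ F a.1 ω * F a.1 ω) P := (hL2 a.1).integrable_mul (hL2 a.1)
    have i2 : Integrable (fun ω ↦ F a.2 ω * F a.2 ω) P := (hL2 a.2).integrable_mul (hL2 a.2)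
    calc ∫ ω, ‖F a.1 ω * F a.2 ω‖ ∂P
          ≤ ∫ ω, (F a.1 ω * F a.1 ω + F a.2 ω * F a.2 ω) / 2 ∂P := by
          refine integral_mono ((hL2 a.1).integrable_mul (hL2 a.2)).norm
            ((i1.add i2).div_const 2) fun ω ↦ ?_
          simp only [Real.norm_eq_abs, abs_mul]
          nlinarith [sq_nonneg (|F a.1 ω| - |F a.2 ω|), abs_mul_abs_self (F a.1 ω),
            abs_mul_abs_self (F a.2 ω)]
      _ = (∫ ω, F a.1 ω * F a.1 ω ∂P + ∫ ω, F a.2 ω * F a.2 ω ∂P) / 2 := by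
          rw [integral_div, integral_add i1 i2]
      _ ≤ M := by linarith
  have hZsq : ∀ ω, ∫ a, F a.1 ω * F a.2 ω ∂(μ.prod μ) = (∫ s, F s ω ∂μ) ^ 2 := fun ω ↦ by
    rw [sq, ← integral_prod_mul]
  have hZm : AEStronglyMeasurable (fun ω ↦ ∫ s, F s ω ∂μ) P :=
    hFi.integral_prod_right.aestronglyMeasurable
  have hZ2 : MemLp (fun ω ↦ ∫ s, F s ω ∂μ) 2 P := by
    refine (memLp_two_iff_integrable_sq hZm).2 ?_
    simpa only [hZsq] using hFFi.integral_prod_right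
  refine ⟨hZ2, ?_⟩
  have hZ0 : ∫ ω, ∫ s, F s ω ∂μ ∂P = 0 := by
    rw [← integral_integral_swap hFi]
    simp [hF, integral_const_mul, hB.integral_eval]
  rw [variance_of_integral_eq_zero hZm.aemeasurable hZ0]
  simp_rw [← hZsq]
  rw [← integral_integral_swap (f := fun (a : ℝ × ℝ) ω ↦ F a.1 ω * F a.2 ω) hFFi,
    integral_prod _ hFFi.integral_prod_left]
  simp_rw [hFF]
  refine integral_congr_ae ?_
  filter_upwards [hmem] with s hs
  refine integral_congr_ae ?_
  filter_upwards [hmem] with t ht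
  rw [Real.coe_toNNReal _ hs.1.le, Real.coe_toNNReal _ ht.1.le]

/-! ### Pathwise solution of the integrated equation -/

/-- Variation of constants for the time integral of an Ornstein-Uhlenbeck path. -/
lemma integral_eq_of_langevin {θ σ : ℝ} {x b : ℝ → ℝ} (hx : Continuous x) (hb : Continuous b)
    (h : ∀ t, 0 ≤ t → x t = -θ * (∫ s in (0 : ℝ)..t, x s) + σ * b t) {T : ℝ} (hT : 0 ≤ T) :
    ∫ s in (0 : ℝ)..T, x s = σ * ∫ s in (0 : ℝ)..T, Real.exp (-(θ * (T - s))) * b s := by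
  -- Integrating factor, normalised to equal `1` at `t = T`; the differentiated product vanishes at
  -- `t = 0` because the integral does.
  have hd : ∀ t ∈ Set.uIcc 0 T, HasDerivAt
      (fun t ↦ Real.exp (-(θ * (T - t))) * ∫ s in (0 : ℝ)..t, x s)
      (σ * (Real.exp (-(θ * (T - t))) * b t)) t := by
    intro t ht
    rw [Set.uIcc_of_le hT] at ht
    have h1 : HasDerivAt (fun t ↦ -(θ * (T - t))) θ t := by
      simpa [Pi.neg_def] using (((hasDerivAt_id t).const_sub T).const_mul θ).neg
    have h2 := h1.exp.mul (hx.integral_hasStrictDerivAt 0 t).hasDerivAt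
    refine h2.congr_deriv ?_
    linear_combination Real.exp (-(θ * (T - t))) * h t ht.1
  have := intervalIntegral.integral_eq_sub_of_hasDerivAt hd
    (by apply Continuous.intervalIntegrable; fun_prop)
  rw [intervalIntegral.integral_const_mul] at this
  simp [this]

/-! ### Closed forms of the covariance integrals -/

lemma integral_mul_min_one {T : ℝ} (hT : 0 ≤ T) :
    ∫ s in (0 : ℝ)..T, ∫ t in (0 : ℝ)..T, (1 : ℝ) * 1 * min s t = T ^ 3 / 3 := by
  have hin : ∀ s ∈ Set.uIcc 0 T, ∫ t in (0 : ℝ)..T, (1 : ℝ) * 1 * min s t =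
      s * T - s ^ 2 / 2 := by
    intro s hs
    rw [Set.uIcc_of_le hT] at hs
    rw [← intervalIntegral.integral_add_adjacent_intervals (b := s)
      (by apply Continuous.intervalIntegrable; fun_prop)
      (by apply Continuous.intervalIntegrable; fun_prop),
      intervalIntegral.integral_congr (g := fun t ↦ t) (a := 0) (b := s),
      intervalIntegral.integral_congr (g := fun t ↦ s) (a := s) (b := T)]
    · simp; ring
    · intro t ht
      rw [Set.uIcc_of_le hs.2] at ht
      simp [ht.1]
    · intro t ht
      rw [Set.uIcc_of_le hs.1] at ht
      simp [ht.2]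
  rw [intervalIntegral.integral_congr hin, intervalIntegral.integral_sub
    (by apply Continuous.intervalIntegrable; fun_prop)
    (by apply Continuous.intervalIntegrable; fun_prop)]
  simp
  ring

lemma integral_mul_min_exp {θ T : ℝ} (hθ : θ ≠ 0) (hT : 0 ≤ T) :
    ∫ s in (0 : ℝ)..T, ∫ t in (0 : ℝ)..T,
      Real.exp (-(θ * (T - s))) * Real.exp (-(θ * (T - t))) * min s t =
      1 / (2 * θ ^ 3) *
        (2 * θ * T + 2 * (Real.exp (-θ * T) - 1) - (1 - Real.exp (-θ * T)) ^ 2) := by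
  set g : ℝ → ℝ := fun t ↦ Real.exp (-(θ * (T - t))) with hg
  have hgc : Continuous g := by fun_prop
  have hgd : ∀ t, HasDerivAt g (θ * g t) t := fun t ↦ by
    have h1 : HasDerivAt (fun t ↦ -(θ * (T - t))) θ t := by
      simpa [Pi.neg_def] using (((hasDerivAt_id t).const_sub T).const_mul θ).neg
    exact h1.exp.congr_deriv (mul_comm _ _)
  have hgT : g T = 1 := by simp [hg]
  have hg0 : g 0 = Real.exp (-θ * T) := by simp [hg]
  -- The inner integral is split at `t = s`, where `min s t` changes branch. Since `g' = θ g`, an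
  -- antiderivative of `g t * t` is `g t * (t / θ - 1 / θ ^ 2)`.
  have hin : ∀ s ∈ Set.uIcc 0 T, ∫ t in (0 : ℝ)..T, g s * g t * min s t =
      g s * (s / θ - g s / θ ^ 2 + g 0 / θ ^ 2) := by
    intro s hs
    rw [Set.uIcc_of_le hT] at hs
    have e1 : ∫ t in (0 : ℝ)..s, g s * g t * min s t =
        g s * (g s * (s / θ - 1 / θ ^ 2)) - g s * (g 0 * (0 / θ - 1 / θ ^ 2)) := by
      rw [intervalIntegral.integral_congr (g := fun t ↦ g s * (g t * t))]
      · refine intervalIntegral.integral_eq_sub_of_hasDerivAt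
          (f := fun t ↦ g s * (g t * (t / θ - 1 / θ ^ 2))) (fun t _ ↦ ?_)
          (by apply Continuous.intervalIntegrable; fun_prop)
        refine (((hgd t).mul (((hasDerivAt_id t).div_const θ).sub_const _)).const_mul
          (g s)).congr_deriv ?_
        simp only [id]; field_simp; ring
      · intro t ht
        rw [Set.uIcc_of_le hs.1] at ht
        simp only [min_eq_right ht.2]; ring
    have e2 : ∫ t in s..T, g s * g t * min s t =
        g s * (g T * (s / θ)) - g s * (g s * (s / θ)) := by
      rw [intervalIntegral.integral_congr (g := fun t ↦ g s * (g t * s))]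
      · refine intervalIntegral.integral_eq_sub_of_hasDerivAt
          (f := fun t ↦ g s * (g t * (s / θ))) (fun t _ ↦ ?_)
          (by apply Continuous.intervalIntegrable; fun_prop)
        refine (((hgd t).mul_const (s / θ)).const_mul (g s)).congr_deriv ?_
        field_simp
      · intro t ht
        rw [Set.uIcc_of_le hs.2] at ht
        simp only [min_eq_left ht.1]; ring
    rw [← intervalIntegral.integral_add_adjacent_intervals (b := s)
      (by apply Continuous.intervalIntegrable; fun_prop)
      (by apply Continuous.intervalIntegrable; fun_prop), e1, e2, hgT]
    ring
  rw [intervalIntegral.integral_congr hin, intervalIntegral.integral_eq_sub_of_hasDerivAt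
    (f := fun s ↦ -(g s) ^ 2 / (2 * θ ^ 3) + g 0 * g s / θ ^ 3
      + g s * (s / θ - 1 / θ ^ 2) / θ) (fun s _ ↦ ?_)
    (by apply Continuous.intervalIntegrable; fun_prop)]
  · simp only [hgT, ← hg0]
    field_simp
    ring
  · refine (((((hgd s).pow 2).neg.div_const _).add
      (((hgd s).const_mul (g 0)).div_const _)).add
      (((hgd s).mul (((hasDerivAt_id s).div_const θ).sub_const _)).div_const θ)).congr_deriv ?_
    simp only [id]; field_simp; push_cast; ring

theorem mainTheorem2 {Ω Ω' : Type*} [MeasurableSpace Ω] [MeasurableSpace Ω']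
    (P : Measure Ω) [IsProbabilityMeasure P] (P' : Measure Ω') [IsProbabilityMeasure P']
    (θ σ : ℝ) (hθ : 0 < θ)
    (X : ℝ≥0 → Ω → ℝ) (hX : IsOrnsteinUhlenbeck X P θ 0 σ 0)
    (W : ℝ≥0 → Ω' → ℝ) (hW : IsBrownianReal W P')
    (T : ℝ) (hT : 0 < T) :
    MemLp (timeIntegral X T) 2 P ∧
    MemLp (timeIntegral W T) 2 P' ∧
    variance (timeIntegral X T) P =
      σ ^ 2 / (2 * θ ^ 3) *
        (2 * θ * T + 2 * (Real.exp (-θ * T) - 1) - (1 - Real.exp (-θ * T)) ^ 2) ∧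
    variance (timeIntegral W T) P' = T ^ 3 / 3 ∧
    variance (timeIntegral X T) P ≤ variance (timeIntegral (fun t ω ↦ σ * W t ω) T) P' ∧
    (|σ| ≤ 1 → variance (timeIntegral X T) P ≤ variance (timeIntegral W T) P') := by
  obtain ⟨B, hB, hsde⟩ := hX.sde
  set g : ℝ → ℝ := fun t ↦ Real.exp (-(θ * (T - t))) with hg
  have hgc : Continuous g := by fun_prop
  have hXB : timeIntegral X T =ᵐ[P] fun ω ↦ σ * ∫ s in (0 : ℝ)..T, g s * B s.toNNReal ω := by
    filter_upwards [hX.cont, hB.cont, hsde] with ω hx hb h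
    refine integral_eq_of_langevin (x := fun s ↦ X s.toNNReal ω) (b := fun s ↦ B s.toNNReal ω)
      (hx.comp continuous_real_toNNReal) (hb.comp continuous_real_toNNReal) (fun t ht ↦ ?_) hT.le
    rw [← intervalIntegral.integral_const_mul]
    simpa [Real.coe_toNNReal t ht] using h t.toNNReal
  obtain ⟨hB2, hBv⟩ := hB.weighted_integral hgc hT.le
  obtain ⟨hW2, hWv⟩ := hW.weighted_integral (continuous_const (y := (1 : ℝ))) hT.le
  have hWt : (fun ω ↦ ∫ s in (0 : ℝ)..T, 1 * W s.toNNReal ω) = timeIntegral W T := by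
    simp [timeIntegral, funext_iff]
  rw [hWt] at hW2 hWv
  have hWσ : timeIntegral (fun t ω ↦ σ * W t ω) T = fun ω ↦ σ * timeIntegral W T ω := by
    simp [timeIntegral, funext_iff]
  have hXv : variance (timeIntegral X T) P = σ ^ 2 *
      ∫ s in (0 : ℝ)..T, ∫ t in (0 : ℝ)..T, g s * g t * min s t := by
    rw [variance_congr hXB, variance_const_mul, hBv]
  -- The only use of the sign of `θ` beyond `θ ≠ 0`: mean reversion makes the weight at most `1`.
  have hle : ∫ s in (0 : ℝ)..T, ∫ t in (0 : ℝ)..T, g s * g t * min s t ≤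
      variance (timeIntegral W T) P' := by
    have hg1 : ∀ t ∈ Set.Icc 0 T, g t ≤ 1 := fun t ht ↦
      Real.exp_le_one_iff.2 (neg_nonpos.2 (mul_nonneg hθ.le (sub_nonneg.2 ht.2)))
    rw [hWv]
    refine intervalIntegral.integral_mono_on hT.le
      (by apply Continuous.intervalIntegrable; fun_prop)
      (by apply Continuous.intervalIntegrable; fun_prop) fun s hs ↦ ?_
    refine intervalIntegral.integral_mono_on hT.le
      (by apply Continuous.intervalIntegrable; fun_prop)
      (by apply Continuous.intervalIntegrable; fun_prop) fun t ht ↦ ?_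
    have := hg1 s hs
    have := hg1 t ht
    have : 0 ≤ min s t := le_min hs.1 ht.1
    have := Real.exp_nonneg (-(θ * (T - t)))
    gcongr
  have hleσ : variance (timeIntegral X T) P ≤ σ ^ 2 * variance (timeIntegral W T) P' :=
    hXv.trans_le (mul_le_mul_of_nonneg_left hle (sq_nonneg σ))
  refine ⟨(memLp_congr_ae hXB).2 (hB2.const_mul σ), hW2, ?_, ?_, ?_, fun hσ ↦ hleσ.trans ?_⟩
  · rw [hXv, integral_mul_min_exp hθ.ne' hT.le]
    ring
  · rw [hWv, integral_mul_min_one hT.le]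
  · rwa [hWσ, variance_const_mul]
  · exact mul_le_of_le_one_left (variance_nonneg _ _) ((sq_le_one_iff_abs_le_one σ).2 hσ)
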